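/- Let $E_1$ and $E_2$ be real metrizable (in particular Hausdorff) locally convex spaces, and for $i=1,2$ let $\mathcal{C}(E_i)$ be the lattice of all closed linear subspaces of $E_i$, ordered by inclusion (the meet is the intersection, the join is the closure of the sum). A lattice isomorphism is a bijection preserving binary joins and meets. 1. There is a bicontinuous linear bijection $E_1\to E_2$ if and only if the lattices $\mathcal{C}(E_1)$ and $\mathcal{C}(E_2)$ are isomorphic. 2. Suppose $\dim E_1\neq 2$. A map $\psi:\mathcal{C}(E_1)\to\mathcal{C}(E_2)$ is a lattice isomorphism if and only if there is a bicontinuous linear bijection $s:E_1\to E_2$ such that $\psi(M)=s(M)$ for every $M\in\mathcal{C}(E_1)$. The "if" part also holds when $\dim E_1=2$. -/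

import Mathlib

/-- A map between lattices is a lattice isomorphism if it is bijective and preserves binary
joins and binary meets. -/
def IsLatticeIsomorphism {L₁ L₂ : Type*} [Lattice L₁] [Lattice L₂] (ψ : L₁ → L₂) : Prop :=
  Function.Bijective ψ ∧ (∀ a b : L₁, ψ (a ⊔ b) = ψ a ⊔ ψ b) ∧
    (∀ a b : L₁, ψ (a ⊓ b) = ψ a ⊓ ψ b)

/-! The atoms of the lattice are the lines, and the join of two lines is their algebraic span, so an
isomorphism induces a map of lines that preserves and reflects coplanarity. In dimension at least 3
the fundamental theorem of projective geometry (`exists_linearEquiv_of_mem_span_iff`) realises it by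
a linear bijection `s`; no field automorphism intervenes, since ℝ has only the identity.

Continuity: `s` pulls closed hyperplanes back to closed subspaces, so `f ∘ s` is continuous for
every continuous functional `f`. Hence `s` maps bounded sets to weakly bounded, thus bounded, sets,
which suffices on a first countable space. The inverse is treated alike.

In finite dimension, spanning by lines makes the dimensions agree; in dimension at most 1 only `⊥`
and `⊤` occur. -/

/-! ### Linearity from additivity on independent pairs. -/

section Semilinear

variable {V W : Type*} [AddCommGroup V] [Module ℝ V] [AddCommGroup W] [Module ℝ W]

theorem linearIndependent_pair_smul_right {x y : V} (h : LinearIndependent ℝ ![x, y]) {t : ℝ}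
    (ht : t ≠ 0) : LinearIndependent ℝ ![x, t • y] := by
  rw [LinearIndependent.pair_iff] at h ⊢
  intro p q hpq
  rw [smul_smul] at hpq
  obtain ⟨h1, h2⟩ := h _ _ hpq
  exact ⟨h1, by simpa [ht] using h2⟩

theorem linearIndependent_pair_symm {x y : V} (h : LinearIndependent ℝ ![x, y]) :
    LinearIndependent ℝ ![y, x] := by
  rw [LinearIndependent.pair_iff] at h ⊢
  intro p q hpq
  exact (h q p (by rw [add_comm]; exact hpq)).symm

theorem linearIndependent_pair_add_smul {x y : V} (h : LinearIndependent ℝ ![x, y]) (t : ℝ) :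
    LinearIndependent ℝ ![x, t • x + y] := by
  rw [LinearIndependent.pair_iff] at h ⊢
  intro p q hpq
  obtain ⟨h1, h2⟩ := h (p + q * t) q (by rw [← hpq]; module)
  subst h2
  exact ⟨by simpa using h1, rfl⟩

theorem exists_smul_eq_of_not_linearIndependent_pair {x y : V} (hx : x ≠ 0)
    (h : ¬ LinearIndependent ℝ ![x, y]) : ∃ c : ℝ, y = c • x := by
  rw [LinearIndependent.pair_iff' hx] at h
  push Not at h
  obtain ⟨c, hc⟩ := h
  exact ⟨c, hc.symm⟩

/-- A map between real vector spaces that maps lines into lines, is additive on independent pairs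
and preserves their independence is linear, provided that its domain has dimension at least two. -/
theorem isLinearMap_of_add_of_linearIndependent {h : V → W} {u v : V}
    (huv : LinearIndependent ℝ ![u, v]) (h0 : h 0 = 0)
    (hadd : ∀ x y, LinearIndependent ℝ ![x, y] → h (x + y) = h x + h y)
    (hind : ∀ x y, LinearIndependent ℝ ![x, y] → LinearIndependent ℝ ![h x, h y])
    (hsmul : ∀ (t : ℝ) x, ∃ c : ℝ, h (t • x) = c • h x) : IsLinearMap ℝ h := by
  choose τ hτ using hsmul
  -- Both factors equal that of `x + y`: compare coefficients in `h (t • (x + y))`.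
  have hτ_indep : ∀ t x y, LinearIndependent ℝ ![x, y] → τ t x = τ t y := by
    intro t x y hxy
    have h1 : h (t • (x + y)) = h (t • x) + h (t • y) := by
      rcases eq_or_ne t 0 with rfl | ht
      · simp [h0]
      · rw [smul_add]
        exact hadd _ _ (linearIndependent_pair_smul_right (linearIndependent_pair_symm
          (linearIndependent_pair_smul_right (linearIndependent_pair_symm hxy) ht)) ht)
    rw [hτ, hτ, hτ, hadd _ _ hxy] at h1
    have h2 := LinearIndependent.pair_iff.1 (hind _ _ hxy) (τ t (x + y) - τ t x)
      (τ t (x + y) - τ t y) (by rw [sub_smul, sub_smul]; rw [smul_add] at h1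
                                rw [sub_add_sub_comm, h1, sub_self])
    linarith [h2.1, h2.2]
  have hu : u ≠ 0 := by simpa using huv.ne_zero 0
  have hhu : h u ≠ 0 := by simpa using (hind _ _ huv).ne_zero 0
  have hσ : ∀ t x, h (t • x) = τ t u • h x := by
    intro t x
    by_cases hx : x = 0
    · simp [hx, h0]
    · by_cases hux : LinearIndependent ℝ ![u, x]
      · rw [hτ, hτ_indep t u x hux]
      -- On the line of `u` the factors are compared through `v`.
      · obtain ⟨c, rfl⟩ := exists_smul_eq_of_not_linearIndependent_pair hu hux
        have hc : c ≠ 0 := by rintro rfl; simp at hx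
        rw [hτ, hτ_indep t u v huv, hτ_indep t v (c • u)
          (linearIndependent_pair_smul_right (linearIndependent_pair_symm huv) hc)]
  have hinj : ∀ {p q : ℝ}, p • h u = q • h u → p = q := fun hpq => smul_left_injective ℝ hhu hpq
  have hσ0 : τ 0 u = 0 := hinj (by rw [← hσ]; simp [h0])
  let σ : ℝ →+* ℝ :=
    { toFun := fun t => τ t u
      map_zero' := hσ0
      map_one' := hinj (by rw [← hσ]; simp)
      map_mul' := fun p q => hinj (by rw [← hσ, mul_smul, hσ, hσ, mul_smul])
      map_add' := fun p q => by
        rcases eq_or_ne p 0 with rfl | hp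
        · rw [hσ0, zero_add, zero_add]
        have key : ∀ r, h (r • u + v) = τ r u • h u + h v := by
          intro r
          rcases eq_or_ne r 0 with rfl | hr
          · simp [hσ0]
          rw [← hσ]
          exact hadd _ _ (linearIndependent_pair_symm
            (linearIndependent_pair_smul_right (linearIndependent_pair_symm huv) hr))
        -- The extra summand `v` makes additivity on independent pairs applicable to `p • u + (q • u
        -- + v)`.
        have h1 := key (p + q)
        rw [add_smul, add_assoc, hadd _ _ (linearIndependent_pair_symm
          (linearIndependent_pair_smul_right (linearIndependent_pair_symm
            (linearIndependent_pair_add_smul huv q)) hp)), key, hσ, ← add_assoc,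
          ← add_smul] at h1
        exact (hinj (add_right_cancel h1)).symm }
  have hid : ∀ t, τ t u = t := fun t =>
    congrArg (fun f : ℝ →+* ℝ => f t) (Subsingleton.elim σ (RingHom.id ℝ))
  have hlin : ∀ (t : ℝ) x, h (t • x) = t • h x := fun t x => by rw [hσ, hid]
  refine ⟨fun x y => ?_, hlin⟩
  by_cases hx : x = 0
  · simp [hx, h0]
  by_cases hxy : LinearIndependent ℝ ![x, y]
  · exact hadd _ _ hxy
  · obtain ⟨c, rfl⟩ := exists_smul_eq_of_not_linearIndependent_pair hx hxy
    have h1 := hlin (1 + c) x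
    rw [add_smul, add_smul, one_smul, one_smul] at h1
    rw [h1, hlin]

end Semilinear

/-! ### Fundamental theorem of projective geometry. -/

section ProjectiveGeometry

open Submodule

variable {V W : Type*} [AddCommGroup V] [Module ℝ V] [AddCommGroup W] [Module ℝ W]

/-- The degenerate spans are written with two generators so that the hypothesis `hg` below rewrites
all three conditions. -/
theorem linearIndependent_triple_iff {x y z : V} :
    LinearIndependent ℝ ![x, y, z] ↔
      x ∉ span ℝ {y, z} ∧ y ∉ span ℝ {z, z} ∧ z ∉ span ℝ {(0 : V), 0} := by
  have : ![x, y, z] = Fin.cons x (Fin.cons y ![z]) := rfl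
  rw [this, linearIndependent_finCons, linearIndependent_finCons]
  simp [Set.pair_comm]
  tauto

theorem linearIndependent_triple_scalars {x y z : V} (h : LinearIndependent ℝ ![x, y, z])
    {p q r : ℝ} (h0 : p • x + q • y + r • z = 0) : p = 0 ∧ q = 0 ∧ r = 0 := by
  have := Fintype.linearIndependent_iff.1 h ![p, q, r] (by simpa [Fin.sum_univ_succ, add_assoc] using h0)
  exact ⟨this 0, this 1, this 2⟩

theorem span_pair_congr {x y x' y' : V} (hx : span ℝ {x} = span ℝ {x'})
    (hy : span ℝ {y} = span ℝ {y'}) : span ℝ {x, y} = span ℝ {x', y'} := by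
  rw [span_insert, span_insert, hx, hy]

theorem mem_iff_mem_of_span_singleton_eq {x y : V} (h : span ℝ {x} = span ℝ {y})
    (S : Submodule ℝ V) : x ∈ S ↔ y ∈ S := by
  rw [← span_singleton_le_iff_mem, h, span_singleton_le_iff_mem]

variable {g : V → W}
  (hg : ∀ x y z, g z ∈ span ℝ {g x, g y} ↔ z ∈ span ℝ {x, y})
include hg

theorem linearIndependent_triple_of_mem_span_iff (hg0 : g 0 = 0) {x y z : V} {x' y' z' : W}
    (h : LinearIndependent ℝ ![x, y, z]) (hx : span ℝ {x'} = span ℝ {g x})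
    (hy : span ℝ {y'} = span ℝ {g y}) (hz : span ℝ {z'} = span ℝ {g z}) :
    LinearIndependent ℝ ![x', y', z'] := by
  rw [linearIndependent_triple_iff] at h ⊢
  rw [span_pair_congr hy hz, span_pair_congr hz hz, mem_iff_mem_of_span_singleton_eq hx,
    mem_iff_mem_of_span_singleton_eq hy, mem_iff_mem_of_span_singleton_eq hz, hg, hg]
  rwa [← hg 0 0 z, hg0] at h

/-- The line of `a + (x + y)` lies in the planes of `a + x, y` and of `a + y, x`, whose images meet
in the line of `a' + x' + y'`. Since `z'` lies in the plane of `x', y'`, the coefficient of `a'`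
fixes the scale. -/
theorem add_of_linearIndependent_triple (hg0 : g 0 = 0) {a x y : V} {a' x' y' z' : W}
    (hi : LinearIndependent ℝ ![a, x, y])
    (ha : span ℝ {a'} = span ℝ {g a}) (hx : span ℝ {x'} = span ℝ {g x})
    (hy : span ℝ {y'} = span ℝ {g y}) (hz : span ℝ {z'} = span ℝ {g (x + y)})
    (hax : span ℝ {a' + x'} = span ℝ {g (a + x)}) (hay : span ℝ {a' + y'} = span ℝ {g (a + y)})
    (haz : span ℝ {a' + z'} = span ℝ {g (a + (x + y))}) : z' = x' + y' := by
  have hi' := linearIndependent_triple_of_mem_span_iff hg hg0 hi ha hx hy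
  have h1 : g (a + (x + y)) ∈ span ℝ {a' + x', y'} := by
    rw [span_pair_congr hax hy, hg]
    exact mem_span_pair.2 ⟨1, 1, by module⟩
  have h2 : g (a + (x + y)) ∈ span ℝ {a' + y', x'} := by
    rw [span_pair_congr hay hx, hg]
    exact mem_span_pair.2 ⟨1, 1, by module⟩
  have h3 : z' ∈ span ℝ {x', y'} := by
    rw [mem_iff_mem_of_span_singleton_eq hz, span_pair_congr hx hy, hg]
    exact mem_span_pair.2 ⟨1, 1, by module⟩
  obtain ⟨p, q, hpq⟩ := mem_span_pair.1 h1
  obtain ⟨r, s, hrs⟩ := mem_span_pair.1 h2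
  obtain ⟨m, n, rfl⟩ := mem_span_pair.1 h3
  obtain ⟨d, hd⟩ := mem_span_singleton.1 (haz ▸ mem_span_singleton_self (a' + (m • x' + n • y')))
  obtain ⟨e1, e2, e3⟩ := linearIndependent_triple_scalars hi'
    (p := p - r) (q := p - s) (r := q - r) (by
      rw [← sub_eq_zero.2 (hpq.trans hrs.symm)]; module)
  obtain rfl : p = r := by linarith
  obtain rfl : p = s := by linarith
  obtain rfl : q = p := by linarith
  rw [← hpq] at hd
  obtain ⟨e4, e5, e6⟩ := linearIndependent_triple_scalars hi'
    (p := d * q - 1) (q := d * q - m) (r := d * q - n) (by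
      rw [← sub_eq_zero.2 hd]; module)
  obtain rfl : m = 1 := by linarith
  obtain rfl : n = 1 := by linarith
  simp

/-- If `a` does not lie on the line of `x`, the line `g (a + x)` contains a point of the form
`g a + x'` with `x'` spanning the line of `g x`. -/
theorem exists_span_add_eq (hg0 : g 0 = 0) {a x : V} (hax : x ≠ 0 → LinearIndependent ℝ ![a, x]) :
    ∃ x', span ℝ {x'} = span ℝ {g x} ∧ span ℝ {g a + x'} = span ℝ {g (a + x)} := by
  by_cases hx : x = 0
  · exact ⟨0, by simp [hx, hg0], by simp [hx]⟩
  replace hax := hax hx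
  have h1 : g (a + x) ∈ span ℝ {g a, g x} := by
    rw [hg]
    exact mem_span_pair.2 ⟨1, 1, by module⟩
  obtain ⟨p, q, hpq⟩ := mem_span_pair.1 h1
  have hp : p ≠ 0 := by
    rintro rfl
    have h2 : g (a + x) ∈ span ℝ {g x, g x} := mem_span_pair.2 ⟨0, q, by rw [← hpq]; module⟩
    rw [hg, Set.pair_eq_singleton, mem_span_singleton] at h2
    obtain ⟨t, ht⟩ := h2
    have := (LinearIndependent.pair_iff.1 hax 1 (1 - t) (by rw [sub_smul, ht]; module)).1
    exact one_ne_zero this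
  have hq : q ≠ 0 := by
    rintro rfl
    have h2 : g (a + x) ∈ span ℝ {g a, g a} := mem_span_pair.2 ⟨0, p, by rw [← hpq]; module⟩
    rw [hg, Set.pair_eq_singleton, mem_span_singleton] at h2
    obtain ⟨t, ht⟩ := h2
    have := (LinearIndependent.pair_iff.1 hax (1 - t) 1 (by rw [sub_smul, ht]; module)).2
    exact one_ne_zero this
  refine ⟨(p⁻¹ * q) • g x, ?_, ?_⟩
  · exact span_singleton_smul_eq (IsUnit.mk0 _ (mul_ne_zero (inv_ne_zero hp) hq)) _
  · rw [← span_singleton_smul_eq (IsUnit.mk0 _ hp), ← hpq, smul_add, smul_smul,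
      mul_inv_cancel_left₀ hp]

/-- The **fundamental theorem of projective geometry** over the reals. -/
theorem exists_linearEquiv_of_mem_span_iff (hg0 : g 0 = 0)
    (hsurj : ∀ w, ∃ v, w ∈ span ℝ {g v}) {a b c : V} (habc : LinearIndependent ℝ ![a, b, c]) :
    ∃ s : V ≃ₗ[ℝ] W, ∀ v, span ℝ {s v} = span ℝ {g v} := by
  have hzero : ∀ z, g z = 0 → z = 0 := fun z hz => by
    have h2 := (hg 0 0 z).1 (by rw [hz]; exact zero_mem _)
    simpa using h2
  have ha : a ≠ 0 := by simpa using habc.ne_zero 0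
  obtain ⟨f, hf⟩ : ∃ f : V →ₗ[ℝ] ℝ, f a = 1 := by
    obtain ⟨f, hf⟩ := Module.exists_dual_forall_apply_eq_one (K := ℝ) (s := {a})
      (v := id) ((linearIndepOn_singleton_iff ℝ).2 ha)
    exact ⟨f, hf a rfl⟩
  have hind2 : ∀ x, f x = 0 → x ≠ 0 → LinearIndependent ℝ ![a, x] := fun x hx hx0 => by
    rw [LinearIndependent.pair_iff]
    intro p q hpq
    have hp : p = 0 := by simpa [hf, hx] using congrArg f hpq
    subst hp
    exact ⟨rfl, by simpa [hx0] using hpq⟩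
  have hind3 : ∀ x y, f x = 0 → f y = 0 → LinearIndependent ℝ ![x, y] →
      LinearIndependent ℝ ![a, x, y] := fun x y hx hy hxy => by
    refine linearIndependent_finCons.2 ⟨hxy, fun hmem => ?_⟩
    have : a ∈ span ℝ {x, y} := by simpa [Set.pair_comm] using hmem
    obtain ⟨p, q, rfl⟩ := mem_span_pair.1 this
    simp [hx, hy] at hf
  have hex : ∀ x : LinearMap.ker f, ∃ x', span ℝ {x'} = span ℝ {g x} ∧
      span ℝ {g a + x'} = span ℝ {g (a + x)} := fun x =>
    exists_span_add_eq hg hg0 (hind2 x x.2)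
  -- Normalising against `g a` selects one vector on each image line of the hyperplane `ker f`.
  choose h hh hah using hex
  have hindK : ∀ x y : LinearMap.ker f, LinearIndependent ℝ ![x, y] →
      LinearIndependent ℝ ![a, (x : V), (y : V)] := fun x y hxy => by
    refine hind3 _ _ x.2 y.2 ?_
    rw [LinearIndependent.pair_iff] at hxy ⊢
    exact fun p q hpq => hxy p q (Subtype.ext hpq)
  have hlin : IsLinearMap ℝ h := by
    refine isLinearMap_of_add_of_linearIndependent
      -- Projecting `b` and `c` along `a` shows that the hyperplane has dimension at least 2.
      (u := ⟨b - f b • a, by simp [hf]⟩) (v := ⟨c - f c • a, by simp [hf]⟩) ?_ ?_ ?_ ?_ ?_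
    · rw [LinearIndependent.pair_iff]
      intro p q hpq
      have h1 : p • (b - f b • a) + q • (c - f c • a) = 0 := congrArg Subtype.val hpq
      exact (linearIndependent_triple_scalars habc (p := -(p * f b + q * f c)) (q := p) (r := q)
        (by rw [← h1]; module)).2
    · have := hh 0
      simpa [hg0] using this
    · exact fun x y hxy => add_of_linearIndependent_triple hg hg0 (hindK x y hxy) rfl
        (hh x) (hh y) (hh (x + y)) (hah x) (hah y) (hah (x + y))
    · intro x y hxy
      exact (linearIndependent_finCons.1 (linearIndependent_triple_of_mem_span_iff hg hg0
        (hindK x y hxy) rfl (hh x) (hh y))).1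
    · intro t x
      have h1 : h (t • x) ∈ span ℝ {g x, g x} := by
        rw [mem_iff_mem_of_span_singleton_eq (hh (t • x)), hg]
        exact mem_span_pair.2 ⟨t, 0, by simp⟩
      rw [Set.pair_eq_singleton, ← hh x] at h1
      obtain ⟨r, hr⟩ := mem_span_singleton.1 h1
      exact ⟨r, hr.symm⟩
  let P : V →ₗ[ℝ] LinearMap.ker f :=
    (LinearMap.id - f.smulRight a).codRestrict (LinearMap.ker f) (fun v => by simp [hf])
  have hP : ∀ v, v = f v • a + (P v : V) := fun v => (add_sub_cancel (f v • a) v).symm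
  let s : V →ₗ[ℝ] W := f.smulRight (g a) + (hlin.mk' h) ∘ₗ P
  have hsv : ∀ v, s v = f v • g a + h (P v) := fun v => rfl
  have hs : ∀ v, span ℝ {s v} = span ℝ {g v} := by
    intro v
    by_cases hv : f v = 0
    · have hPv : (P v : V) = v := by
        have := hP v
        rw [hv, zero_smul, zero_add] at this
        exact this.symm
      rw [hsv, hv, zero_smul, zero_add, hh, hPv]
    · have h1 : s v = f v • (g a + h ((f v)⁻¹ • P v)) := by
        rw [hsv, hlin.map_smul, smul_add, smul_inv_smul₀ hv]
      have h2 : f v • (a + (((f v)⁻¹ • P v : LinearMap.ker f) : V)) = v := by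
        rw [coe_smul, smul_add, smul_inv_smul₀ hv, ← hP]
      have hgs : ∀ (t : ℝ) (x : V), t ≠ 0 → span ℝ {g (t • x)} = span ℝ {g x} := by
        intro t x ht
        refine le_antisymm ?_ ?_ <;> rw [span_singleton_le_iff_mem]
        · have := (hg x x (t • x)).2 (mem_span_pair.2 ⟨t, 0, by simp⟩)
          rwa [Set.pair_eq_singleton] at this
        · have := (hg (t • x) (t • x) x).2 (mem_span_pair.2 ⟨t⁻¹, 0, by simp [ht]⟩)
          rwa [Set.pair_eq_singleton] at this
      rw [h1, span_singleton_smul_eq (IsUnit.mk0 _ hv), hah, ← hgs _ _ hv, h2]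
  refine ⟨LinearEquiv.ofBijective s ⟨?_, fun w => ?_⟩, hs⟩
  · rw [← LinearMap.ker_eq_bot, LinearMap.ker_eq_bot']
    intro v hv
    have := hs v
    rw [hv, span_zero_singleton, eq_comm, span_singleton_eq_bot] at this
    exact hzero v this
  · obtain ⟨v, hv⟩ := hsurj w
    rw [← hs] at hv
    obtain ⟨t, ht⟩ := mem_span_singleton.1 hv
    exact ⟨t • v, by rw [map_smul, ht]⟩

end ProjectiveGeometry

/-! ### Weak boundedness and continuity. -/

section Mackey

/-- Uniform boundedness for `S` seen in the bidual: the dual is complete even if `F` is not. -/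
theorem exists_forall_norm_le_of_forall_dual {F : Type*} [SeminormedAddCommGroup F]
    [NormedSpace ℝ F] {S : Set F} (h : ∀ f : StrongDual ℝ F, ∃ C, ∀ x ∈ S, ‖f x‖ ≤ C) :
    ∃ C, ∀ x ∈ S, ‖x‖ ≤ C := by
  obtain ⟨C, hC⟩ := banach_steinhaus (g := fun x : S => NormedSpace.inclusionInDoubleDual ℝ F x)
    (fun f => by
      obtain ⟨C, hC⟩ := h f
      exact ⟨C, fun x => hC x x.2⟩)
  refine ⟨C, fun x hx => ?_⟩
  obtain ⟨f, hf, hfx⟩ := exists_dual_vector'' ℝ x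
  have h1 : ‖f x‖ ≤ ‖NormedSpace.inclusionInDoubleDual ℝ F x‖ * ‖f‖ :=
    (NormedSpace.inclusionInDoubleDual ℝ F x).le_opNorm f
  rw [hfx] at h1
  calc ‖x‖ ≤ ‖((‖x‖ : ℝ) : ℝ)‖ := by simp
    _ ≤ _ := h1
    _ ≤ ‖NormedSpace.inclusionInDoubleDual ℝ F x‖ * 1 := by gcongr
    _ ≤ C := by rw [mul_one]; exact hC ⟨x, hx⟩

theorem Seminorm.exists_forall_le_of_forall_linearMap {E : Type*} [AddCommGroup E] [Module ℝ E]
    (q : Seminorm ℝ E) {S : Set E}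
    (h : ∀ f : E →ₗ[ℝ] ℝ, (∃ C, ∀ x, ‖f x‖ ≤ C * q x) → ∃ C, ∀ x ∈ S, ‖f x‖ ≤ C) :
    ∃ C, ∀ x ∈ S, q x ≤ C := by
  let _ : SeminormedAddCommGroup E := q.toSeminormedAddCommGroup
  let _ : NormedSpace ℝ E := { norm_smul_le := fun a x => (map_smul_eq_mul q a x).le }
  exact exists_forall_norm_le_of_forall_dual (S := S) fun f => h f ⟨‖f‖, f.le_opNorm⟩

variable {E F : Type*} [AddCommGroup E] [Module ℝ E] [TopologicalSpace E]
  [IsTopologicalAddGroup E] [ContinuousSMul ℝ E] [AddCommGroup F] [Module ℝ F]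
  [TopologicalSpace F] [IsTopologicalAddGroup F] [ContinuousSMul ℝ F] [LocallyConvexSpace ℝ F]

/-- In a locally convex space, weakly bounded sets are bounded. -/
theorem isVonNBounded_of_forall_dual {S : Set F}
    (h : ∀ f : StrongDual ℝ F, ∃ C, ∀ x ∈ S, ‖f x‖ ≤ C) : Bornology.IsVonNBounded ℝ S := by
  have hF := with_gaugeSeminormFamily (𝕜 := ℝ) (E := F)
  rw [hF.isVonNBounded_iff_seminorm_bounded]
  intro i
  set q := gaugeSeminormFamily ℝ F i
  obtain ⟨C, hC⟩ := q.exists_forall_le_of_forall_linearMap (S := S) fun f hf => by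
    obtain ⟨C, hC⟩ := hf
    have hq : Continuous q := hF.continuous_seminorm i
    have hf : Continuous f := by
      refine continuous_of_continuousAt_zero f ?_
      rw [ContinuousAt, map_zero]
      refine squeeze_zero_norm hC ?_
      have := (hq.const_mul C).tendsto 0
      rwa [map_zero, mul_zero] at this
    exact h ⟨f, hf⟩
  exact ⟨max C 0 + 1, by positivity, fun x hx =>
    ((hC x hx).trans (le_max_left _ _)).trans_lt (lt_add_one _)⟩

theorem LinearMap.continuous_of_forall_continuous_dual_comp [FirstCountableTopology E]
    (s : E →ₗ[ℝ] F) (h : ∀ f : StrongDual ℝ F, Continuous fun x => f (s x)) : Continuous s := by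
  refine s.continuous_of_locally_bounded fun S hS => isVonNBounded_of_forall_dual fun f => ?_
  let fs : E →L[ℝ] ℝ := ⟨f.toLinearMap ∘ₗ s, h f⟩
  obtain ⟨C, hC⟩ := ((NormedSpace.isVonNBounded_iff ℝ).1 (hS.image fs)).exists_norm_le
  refine ⟨C, ?_⟩
  rintro _ ⟨x, hx, rfl⟩
  exact hC _ ⟨x, hx, rfl⟩

end Mackey

/-! ### Lines and isomorphisms in the lattice of closed subspaces. -/

section ClosedSubmoduleLattice

open Submodule

theorem IsLatticeIsomorphism.exists_orderIso {L₁ L₂ : Type*} [Lattice L₁] [Lattice L₂]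
    {ψ : L₁ → L₂} (hψ : IsLatticeIsomorphism ψ) : ∃ e : L₁ ≃o L₂, ⇑e = ψ :=
  ⟨{ Equiv.ofBijective ψ hψ.1 with
      map_rel_iff' := fun {a b} => by
        change ψ a ≤ ψ b ↔ a ≤ b
        rw [← sup_eq_right, ← hψ.2.1, hψ.1.1.eq_iff, sup_eq_right] }, rfl⟩

theorem ClosedSubmodule.exists_ne_zero_of_ne_bot {E : Type*} [AddCommGroup E] [Module ℝ E]
    [TopologicalSpace E] [T1Space E] {M : ClosedSubmodule ℝ E} (hM : M ≠ ⊥) :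
    ∃ x ∈ M, x ≠ 0 :=
  Submodule.exists_mem_ne_zero_of_ne_bot (p := M.toSubmodule)
    fun h => hM (ClosedSubmodule.toSubmodule_injective h)

section Line

variable {E : Type*} [AddCommGroup E] [Module ℝ E] [TopologicalSpace E]
    [IsTopologicalAddGroup E] [ContinuousSMul ℝ E] [T2Space E]

/-- The line spanned by a vector, as a closed submodule. -/
def closedLine (x : E) : ClosedSubmodule ℝ E :=
  ⟨span ℝ {x}, Submodule.closed_of_finiteDimensional _⟩

theorem closedLine_le_iff {x : E} {M : ClosedSubmodule ℝ E} : closedLine x ≤ M ↔ x ∈ M :=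
  span_singleton_le_iff_mem x M.toSubmodule

theorem closedLine_zero : closedLine (0 : E) = ⊥ :=
  ClosedSubmodule.toSubmodule_injective (span_zero_singleton ℝ)

theorem mem_closedLine {x y : E} : y ∈ closedLine x ↔ y ∈ span ℝ {x} := Iff.rfl

theorem closedLine_eq_iff {x y : E} :
    closedLine x = closedLine y ↔ span ℝ {x} = span ℝ {y} :=
  ClosedSubmodule.toSubmodule_injective.eq_iff.symm

theorem isAtom_closedLine {x : E} (hx : x ≠ 0) : IsAtom (closedLine x) := by
  refine isAtom_iff_le_of_ge.2 ⟨fun h => hx ?_, fun M hM hle => ?_⟩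
  · have : x ∈ closedLine x := mem_span_singleton_self x
    rwa [h] at this
  · obtain ⟨y, hy, hy0⟩ := ClosedSubmodule.exists_ne_zero_of_ne_bot hM
    obtain ⟨c, rfl⟩ := mem_span_singleton.1 (hle hy)
    have hc : c ≠ 0 := by rintro rfl; simp at hy0
    rw [closedLine_le_iff]
    simpa [hc] using M.smul_mem c⁻¹ hy

theorem exists_closedLine_eq_of_isAtom {A : ClosedSubmodule ℝ E} (hA : IsAtom A) :
    ∃ x, A = closedLine x := by
  obtain ⟨x, hx, hx0⟩ := ClosedSubmodule.exists_ne_zero_of_ne_bot hA.1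
  refine ⟨x, ((hA.le_iff.1 (closedLine_le_iff.2 hx)).resolve_left fun h => ?_).symm⟩
  exact (isAtom_closedLine hx0).1 h

/-- The closure in the join adds nothing, finite-dimensional subspaces being closed. -/
theorem iSup_closedLine {ι : Type*} [Finite ι] (b : ι → E) :
    (⨆ i, closedLine (b i)).toSubmodule = span ℝ (Set.range b) := by
  rw [ClosedSubmodule.toSubmodule_iSup]
  have h1 : ⨆ i, (closedLine (b i)).toSubmodule = span ℝ (Set.range b) :=
    (span_range_eq_iSup (R := ℝ) (v := b)).symm
  rw [h1]
  have : FiniteDimensional ℝ (span ℝ (Set.range b)) :=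
    FiniteDimensional.span_of_finite ℝ (Set.finite_range b)
  exact (span ℝ (Set.range b)).closed_of_finiteDimensional.submodule_topologicalClosure_eq

theorem mem_closedLine_sup {x y z : E} :
    z ∈ closedLine x ⊔ closedLine y ↔ z ∈ span ℝ {x, y} := by
  have h := iSup_closedLine ![x, y]
  have h1 : closedLine x ⊔ closedLine y = ⨆ i, closedLine (![x, y] i) :=
    le_antisymm (sup_le (le_iSup (fun i => closedLine (![x, y] i)) 0)
      (le_iSup (fun i => closedLine (![x, y] i)) 1))
      (iSup_le fun i => by fin_cases i; exacts [le_sup_left, le_sup_right])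
  rw [h1, ← ClosedSubmodule.mem_toSubmodule_iff, h]
  simp [Set.pair_comm]

end Line

variable {E₁ : Type*} [AddCommGroup E₁] [Module ℝ E₁] [TopologicalSpace E₁]
    [IsTopologicalAddGroup E₁] [ContinuousSMul ℝ E₁]
    {E₂ : Type*} [AddCommGroup E₂] [Module ℝ E₂] [TopologicalSpace E₂]
    [IsTopologicalAddGroup E₂] [ContinuousSMul ℝ E₂]

theorem continuous_of_mem_iff [LocallyConvexSpace ℝ E₂] [FirstCountableTopology E₁]
    (s : E₁ →ₗ[ℝ] E₂) (h : ∀ N : ClosedSubmodule ℝ E₂, ∃ M : ClosedSubmodule ℝ E₁,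
      ∀ x, s x ∈ N ↔ x ∈ M) : Continuous s := by
  refine s.continuous_of_forall_continuous_dual_comp fun f => ?_
  refine (f.toLinearMap ∘ₗ s).continuous_iff_isClosed_ker.2 ?_
  obtain ⟨M, hM⟩ := h ⟨LinearMap.ker f.toLinearMap, f.isClosed_ker⟩
  convert M.isClosed using 1
  ext x
  exact hM x

theorem isLatticeIsomorphism_of_continuousLinearEquiv
    {ψ : ClosedSubmodule ℝ E₁ → ClosedSubmodule ℝ E₂} (s : E₁ ≃L[ℝ] E₂)
    (hs : ∀ M : ClosedSubmodule ℝ E₁, (ψ M : Set E₂) = s '' (M : Set E₁)) :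
    IsLatticeIsomorphism ψ := by
  obtain rfl : ψ = ClosedSubmodule.mapEquiv s := funext fun M => SetLike.coe_injective (hs M)
  exact ⟨(ClosedSubmodule.mapEquiv s).bijective, fun _ _ => ClosedSubmodule.mapEquiv_sup_eq s,
    fun _ _ => ClosedSubmodule.mapEquiv_inf_eq s⟩

variable [T2Space E₁] [T2Space E₂]

theorem exists_map_closedLine_eq (e : ClosedSubmodule ℝ E₁ ≃o ClosedSubmodule ℝ E₂) (x : E₁) :
    ∃ y, e (closedLine x) = closedLine y := by
  by_cases hx : x = 0
  · exact ⟨0, by rw [hx, closedLine_zero, closedLine_zero, e.map_bot]⟩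
  · exact exists_closedLine_eq_of_isAtom ((e.isAtom_iff _).2 (isAtom_closedLine hx))

theorem finiteDimensional_of_closedSubmodule_orderIso [FiniteDimensional ℝ E₁]
    (e : ClosedSubmodule ℝ E₁ ≃o ClosedSubmodule ℝ E₂) :
    FiniteDimensional ℝ E₂ ∧ Module.finrank ℝ E₂ ≤ Module.finrank ℝ E₁ := by
  choose g hg using exists_map_closedLine_eq e
  let b := Module.finBasis ℝ E₁
  have h1 : ⨆ i, closedLine (b i) = ⊤ :=
    ClosedSubmodule.toSubmodule_injective ((iSup_closedLine b).trans b.span_eq)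
  have h2 : span ℝ (Set.range (g ∘ b)) = ⊤ := by
    have := congrArg e h1
    rw [e.map_iSup, e.map_top] at this
    simp only [hg] at this
    rw [← iSup_closedLine (g ∘ b), Function.comp_def, this, ClosedSubmodule.toSubmodule_top]
  refine ⟨⟨fg_def.2 ⟨_, Set.finite_range _, h2⟩⟩, ?_⟩
  rw [← finrank_top ℝ E₂, ← h2]
  exact (finrank_range_le_card (R := ℝ) (g ∘ b)).trans_eq (Fintype.card_fin _)

theorem exists_linearEquiv_of_closedSubmodule_orderIso
    (e : ClosedSubmodule ℝ E₁ ≃o ClosedSubmodule ℝ E₂) {a b c : E₁}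
    (habc : LinearIndependent ℝ ![a, b, c]) :
    ∃ s : E₁ ≃ₗ[ℝ] E₂, ∀ M x, s x ∈ e M ↔ x ∈ M := by
  choose g hg using exists_map_closedLine_eq e
  obtain ⟨s, hs⟩ := exists_linearEquiv_of_mem_span_iff (g := g)
    (fun x y z => by
      rw [← mem_closedLine_sup, ← mem_closedLine_sup, ← closedLine_le_iff, ← closedLine_le_iff,
        ← hg, ← hg, ← hg, ← e.map_sup, e.le_iff_le])
    (by
      have := hg 0
      rw [closedLine_zero, e.map_bot, ← closedLine_zero, closedLine_eq_iff,
        span_zero_singleton] at this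
      exact span_singleton_eq_bot.1 this.symm)
    (fun w => by
      obtain ⟨v, hv⟩ := exists_map_closedLine_eq e.symm w
      refine ⟨v, ?_⟩
      rw [← mem_closedLine, ← hg, ← hv, e.apply_symm_apply]
      exact mem_span_singleton_self w) habc
  refine ⟨s, fun M x => ?_⟩
  rw [← closedLine_le_iff, ← closedLine_le_iff, closedLine_eq_iff.2 (hs x), ← hg, e.le_iff_le]

theorem exists_continuousLinearEquiv_of_closedSubmodule_orderIso
    [LocallyConvexSpace ℝ E₁] [LocallyConvexSpace ℝ E₂]
    [FirstCountableTopology E₁] [FirstCountableTopology E₂]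
    (e : ClosedSubmodule ℝ E₁ ≃o ClosedSubmodule ℝ E₂) {a b c : E₁}
    (habc : LinearIndependent ℝ ![a, b, c]) :
    ∃ s : E₁ ≃L[ℝ] E₂, ∀ M, (e M : Set E₂) = s '' (M : Set E₁) := by
  obtain ⟨s, hs⟩ := exists_linearEquiv_of_closedSubmodule_orderIso e habc
  refine ⟨⟨s, ?_, ?_⟩, fun M => ?_⟩
  · exact continuous_of_mem_iff s.toLinearMap fun N => ⟨e.symm N, fun x => by
      simp [← hs (e.symm N)]⟩
  · exact continuous_of_mem_iff s.symm.toLinearMap fun M => ⟨e M, fun y => by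
      simp [← hs M]⟩
  · ext y
    have := hs M (s.symm y)
    rw [s.apply_symm_apply] at this
    refine this.trans ⟨fun h => ⟨_, h, s.apply_symm_apply y⟩, ?_⟩
    rintro ⟨x, hx, rfl⟩
    change s.symm (s x) ∈ M
    rwa [s.symm_apply_apply]

end ClosedSubmoduleLattice

/-! ### Dimension cases and conclusion. -/

theorem exists_linearIndependent_triple {V : Type*} [AddCommGroup V] [Module ℝ V]
    (h : FiniteDimensional ℝ V → 3 ≤ Module.finrank ℝ V) :
    ∃ a b c : V, LinearIndependent ℝ ![a, b, c] := by
  have h3 : ((3 : ℕ) : Cardinal) ≤ Module.rank ℝ V := by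
    by_cases hV : FiniteDimensional ℝ V
    · rw [← Module.finrank_eq_rank]
      exact_mod_cast h hV
    · have : Cardinal.aleph0 ≤ Module.rank ℝ V := by
        rwa [← not_lt, Module.rank_lt_aleph0_iff]
      exact (Cardinal.natCast_le_aleph0).trans this
  obtain ⟨v, hv⟩ := Module.le_rank_iff.1 h3
  refine ⟨v 0, v 1, v 2, ?_⟩
  convert hv using 1
  ext i
  fin_cases i <;> rfl

theorem Submodule.eq_bot_or_eq_top_of_finrank_le_one {V : Type*} [AddCommGroup V] [Module ℝ V]
    [FiniteDimensional ℝ V] (h : Module.finrank ℝ V ≤ 1) (M : Submodule ℝ V) :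
    M = ⊥ ∨ M = ⊤ := by
  rcases Nat.eq_zero_or_pos (Module.finrank ℝ M) with h0 | h0
  · exact Or.inl (Submodule.finrank_eq_zero.1 h0)
  · exact Or.inr (Submodule.eq_top_of_finrank_eq (le_antisymm M.finrank_le (h.trans h0)))

theorem corollary3
    {E₁ : Type*} [AddCommGroup E₁] [Module ℝ E₁] [TopologicalSpace E₁]
    [IsTopologicalAddGroup E₁] [ContinuousSMul ℝ E₁] [LocallyConvexSpace ℝ E₁]
    [TopologicalSpace.MetrizableSpace E₁]
    {E₂ : Type*} [AddCommGroup E₂] [Module ℝ E₂] [TopologicalSpace E₂]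
    [IsTopologicalAddGroup E₂] [ContinuousSMul ℝ E₂] [LocallyConvexSpace ℝ E₂]
    [TopologicalSpace.MetrizableSpace E₂] :
    (Nonempty (E₁ ≃L[ℝ] E₂) ↔
      ∃ ψ : ClosedSubmodule ℝ E₁ → ClosedSubmodule ℝ E₂, IsLatticeIsomorphism ψ) ∧
    (Module.finrank ℝ E₁ ≠ 2 →
      ∀ ψ : ClosedSubmodule ℝ E₁ → ClosedSubmodule ℝ E₂,
        IsLatticeIsomorphism ψ ↔
          ∃ s : E₁ ≃L[ℝ] E₂, ∀ M : ClosedSubmodule ℝ E₁, (ψ M : Set E₂) = s '' (M : Set E₁)) ∧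
    (∀ ψ : ClosedSubmodule ℝ E₁ → ClosedSubmodule ℝ E₂,
      (∃ s : E₁ ≃L[ℝ] E₂, ∀ M : ClosedSubmodule ℝ E₁, (ψ M : Set E₂) = s '' (M : Set E₁)) →
        IsLatticeIsomorphism ψ) := by
  have hfin : FiniteDimensional ℝ E₁ → (ClosedSubmodule ℝ E₁ ≃o ClosedSubmodule ℝ E₂) →
      Nonempty (E₁ ≃L[ℝ] E₂) := fun _ e => by
    obtain ⟨_, hle⟩ := finiteDimensional_of_closedSubmodule_orderIso e
    obtain ⟨-, hge⟩ := finiteDimensional_of_closedSubmodule_orderIso e.symm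
    exact ⟨ContinuousLinearEquiv.ofFinrankEq (hge.antisymm hle)⟩
  refine ⟨⟨fun ⟨s⟩ => ⟨ClosedSubmodule.mapEquiv s,
    isLatticeIsomorphism_of_continuousLinearEquiv s fun _ => rfl⟩, fun ⟨ψ, hψ⟩ => ?_⟩,
    fun h2 ψ => ⟨fun hψ => ?_, fun ⟨s, hs⟩ => isLatticeIsomorphism_of_continuousLinearEquiv s hs⟩,
    fun ψ ⟨s, hs⟩ => isLatticeIsomorphism_of_continuousLinearEquiv s hs⟩
  · obtain ⟨e, rfl⟩ := hψ.exists_orderIso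
    by_cases hE : FiniteDimensional ℝ E₁
    · exact hfin hE e
    · obtain ⟨a, b, c, habc⟩ := exists_linearIndependent_triple fun h => absurd h hE
      obtain ⟨s, -⟩ := exists_continuousLinearEquiv_of_closedSubmodule_orderIso e habc
      exact ⟨s⟩
  · obtain ⟨e, rfl⟩ := hψ.exists_orderIso
    -- `finrank` is 0 in infinite dimension, so finiteness must be tested as well.
    by_cases hE : FiniteDimensional ℝ E₁ ∧ Module.finrank ℝ E₁ ≤ 1
    · obtain ⟨hE, h1⟩ := hE
      obtain ⟨s⟩ := hfin hE e
      refine ⟨s, fun M => ?_⟩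
      rcases Submodule.eq_bot_or_eq_top_of_finrank_le_one h1 M.toSubmodule with h | h
      · obtain rfl : M = ⊥ := ClosedSubmodule.toSubmodule_injective h
        simp
      · obtain rfl : M = ⊤ := ClosedSubmodule.toSubmodule_injective h
        simp
    · obtain ⟨a, b, c, habc⟩ := exists_linearIndependent_triple (V := E₁) fun h => by
        have : ¬ Module.finrank ℝ E₁ ≤ 1 := fun h1 => hE ⟨h, h1⟩
        lia
      exact exists_continuousLinearEquiv_of_closedSubmodule_orderIso e habc
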